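/- Let $R$ be a finite associative ring with identity which is Frobenius, i.e. $R/\mathrm{Rad}(R)\cong \mathrm{Soc}(R_R)$ as right $R$-modules and $R/\mathrm{Rad}(R)\cong \mathrm{Soc}({}_RR)$ as left $R$-modules, where $\mathrm{Rad}$ is the Jacobson radical and $\mathrm{Soc}$ the socle. Let $m,n,d\ge 0$ be integers, $E=\{1,\dots,n\}$, and let $E_d$ be the set of $d$-element subsets of $E$. Let $f=\sum_{Z\in E_d} f(Z)\,Z$ be an element of $\mathrm{Harm}_d(n)$, the kernel of the linear map on the real vector space $\mathbb{R}E_d$ with basis $E_d$ that sends each $Z\in E_d$ to $\sum_{Y\subseteq Z,\ |Y|=d-1} Y$. For $X\subseteq E$ put $\widetilde f(X)=\sum_{Z\in E_d,\ Z\subseteq X} f(Z)$. For a left or right $R$-linear code $C$ of length $n$ (a left or right $R$-submodule of $R^n$) and $X\subseteq E$, let $A_C^{[m]}(X)$ be the number of $m$-tuples $(u_1,\dots,u_m)\in C^m$ with $\mathrm{supp}(u_1)\cup\dots\cup\mathrm{supp}(u_m)=X$, where $\mathrm{supp}(u)=\{i\in E: u_i\ne 0\}$, and define the $m$-tuple harmonic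 weight enumerator $$W^{[m]}_{C,f}(x,y)=\sum_{X\subseteq E}\widetilde f(X)\,A_C^{[m]}(X)\,x^{n-|X|}y^{|X|}\in\mathbb{R}[x,y].$$ Let $C$ be a left $R$-linear code of length $n$, with right dual code $C^\perp=\{u\in R^n : \sum_{i=1}^n v_iu_i=0 \text{ for all } v\in C\}$. Then there are (necessarily unique) polynomials $Z^{[m]}_{C,f},Z^{[m]}_{C^\perp,f}\in\mathbb{R}[x,y]$ with $$W^{[m]}_{C,f}=(xy)^dZ^{[m]}_{C,f},\qquad W^{[m]}_{C^\perp,f}=(xy)^dZ^{[m]}_{C^\perp,f},$$ both are homogeneous of degree $n-2d$ (for $n<2d$ this means that both are zero), and $$Z^{[m]}_{C^\perp,f}(x,y)=(-1)^d\,\frac{(|R|^m)^d}{|C|^m}\;Z^{[m]}_{C,f}\bigl(x+(|R|^m-1)y,\;x-y\bigr).$$ -/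

import Mathlib

namespace HarmonicCodes

noncomputable section

/-! ### Discrete harmonic functions -/

/-- The set `E_d` of subsets of size `d` of `E = Fin n`. -/
abbrev Layer (n d : ℕ) : Type := {Z : Finset (Fin n) // Z.card = d}

/-- The set of subsets of size `d - 1` of `E = Fin n`; it is empty for `d = 0`. -/
abbrev LowerLayer (n d : ℕ) : Type := {Y : Finset (Fin n) // Y.card + 1 = d}

/-- The differentiation on the real vector space with basis `E_d`: the linear map that sends
`Z` to the sum of all subsets `Y` of `Z` of size `d - 1`. -/
def gamma (n d : ℕ) : (Layer n d →₀ ℝ) →ₗ[ℝ] (LowerLayer n d →₀ ℝ) :=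
  Finsupp.linearCombination ℝ fun Z : Layer n d =>
    ∑ Y : LowerLayer n d with Y.1 ⊆ Z.1, Finsupp.single Y (1 : ℝ)

/-- The space `Harm_d(n)` of harmonic functions of degree `d`. -/
def Harm (n d : ℕ) : Submodule ℝ (Layer n d →₀ ℝ) := LinearMap.ker (gamma n d)

/-- The extension of `f` to all subsets of `E`. -/
def tilde {n d : ℕ} (f : Layer n d →₀ ℝ) (X : Finset (Fin n)) : ℝ :=
  ∑ Z : Layer n d with Z.1 ⊆ X, f Z

/-! ### Frobenius rings -/

/-- The socle of a module: the sum of its simple submodules. -/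
def socle (S M : Type*) [Ring S] [AddCommGroup M] [Module S M] : Submodule S M :=
  sSup {N : Submodule S M | IsSimpleModule S N}

/-- The Jacobson radical of `R`, seen as a right ideal. -/
def rightRad (R : Type*) [Ring R] : Submodule Rᵐᵒᵖ R where
  carrier := {a | a ∈ Ring.jacobson R}
  add_mem' := fun ha hb => (Ring.jacobson R).add_mem ha hb
  zero_mem' := (Ring.jacobson R).zero_mem
  smul_mem' := fun c _ ha => Ideal.mul_mem_right c.unop (Ring.jacobson R) ha

/-- The Frobenius property: `R / Rad R` is isomorphic to the socle of `R`, both as right and as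
left modules. (Right modules are modules over `Rᵐᵒᵖ`.) -/
structure IsFrobeniusRing (R : Type*) [Ring R] : Prop where
  right : Nonempty ((R ⧸ rightRad R) ≃ₗ[Rᵐᵒᵖ] socle Rᵐᵒᵖ R)
  left : Nonempty ((R ⧸ Ring.jacobson R) ≃ₗ[R] socle R R)

/-! ### Codes -/

/-- The right dual code of a left linear code. -/
def rightDual {R : Type*} [Ring R] {n : ℕ} (D : Submodule R (Fin n → R)) :
    Submodule Rᵐᵒᵖ (Fin n → R) where
  carrier := {u | ∀ v ∈ D, v ⬝ᵥ u = 0}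
  add_mem' := fun {a b} ha hb v hv => by
    rw [dotProduct_add, ha v hv, hb v hv, add_zero]
  zero_mem' := fun v _ => dotProduct_zero v
  smul_mem' := fun c u hu v hv => by
    rw [dotProduct_smul, hu v hv, smul_zero]

open Classical in
/-- The support of a vector. -/
def supp {R : Type*} [Ring R] {n : ℕ} (u : Fin n → R) : Finset (Fin n) :=
  {i | u i ≠ 0}

/-- The number of `m`-tuples of words of `C` whose supports have union `X`. -/
def tupleCount {R : Type*} [Ring R] {n : ℕ} (m : ℕ) (C : Set (Fin n → R))
    (X : Finset (Fin n)) : ℕ :=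
  Nat.card {u : Fin m → C // (Finset.univ.biUnion fun i => supp (u i).1) = X}

/-- The `m`-tuple harmonic weight enumerator of `C` associated to `f`, a polynomial in the
variables `x = X 0` and `y = X 1`. It depends only on the set of words of `C`, and is used for
left and for right linear codes. -/
def harmonicWeightEnumerator {R : Type*} [Ring R] {n d : ℕ} (m : ℕ) (C : Set (Fin n → R))
    (f : Layer n d →₀ ℝ) : MvPolynomial (Fin 2) ℝ :=
  ∑ X : Finset (Fin n), MvPolynomial.C (tilde f X * (tupleCount m C X : ℝ)) *
    MvPolynomial.X 0 ^ (Xᶜ).card * MvPolynomial.X 1 ^ X.card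

end

end HarmonicCodes

/-!
A character of `R` whose kernel contains no nonzero left ideal turns the dot product into a pairing
of abelian groups, and comparing the two kernels of this pairing, restricted to the vectors with
support in `J`, gives the shortened form `|C| |C^⊥(J)| = |R| ^ |J| |C(Jᶜ)|` of the MacWilliams
identity, where `C(J)` is the set of words of `C` with support in `J`. For a Frobenius ring such a
character exists: pull one back from the semisimple quotient `R / Rad R` to the socle, and extend
it to `R`.

Since `∑_{T ⊆ J} A_C^{[m]}(T) = |C(J)| ^ m`, the enumerator should be expanded in the numbers
`|C(J)|`. Harmonicity says that the sum of `f` over the `d`-sets containing a fixed set of fewer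
than `d` elements vanishes, and this turns the binomial expansion into
`f̃(T) x^{n-|T|} y^{|T|} = (xy)^d ∑_{J ⊇ T} f̃(J) y^{|J|-d} (x-y)^{n-|J|-d}`. Hence
`Z = ∑_J f̃(J) |C(J)| ^ m y^{|J|-d} (x-y)^{n-|J|-d}`, and the substitution of the theorem, which
sends `x - y` to `|R|^m y` and `y` to `x - y`, exchanges `J` with `Jᶜ`, where
`f̃(Jᶜ) = (-1)^d f̃(J)`.
-/

namespace HarmonicCodes

section GeneratingCharacter

variable {R S : Type*} [Ring R] [Ring S]

/-- A left generating character of `R`: a `ℚ/ℤ`-valued character of the additive group of `R`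
whose kernel contains no nonzero left ideal. It suffices to exclude the principal ones. -/
def IsLeftGenerating (φ : CharacterModule R) : Prop :=
  ∀ a : R, (∀ r : R, φ (r * a) = 0) → a = 0

theorem exists_isLeftGenerating_of_divisionRing (D : Type*) [DivisionRing D] :
    ∃ φ : CharacterModule D, IsLeftGenerating φ := by
  obtain ⟨φ, hφ⟩ :=
    CharacterModule.exists_character_apply_ne_zero_of_ne_zero (one_ne_zero (α := D))
  refine ⟨φ, fun a ha => ?_⟩
  by_contra hne
  exact hφ (inv_mul_cancel₀ hne ▸ ha a⁻¹)

theorem exists_isLeftGenerating_matrix (ι : Type*) [Fintype ι] [DecidableEq ι]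
    (h : ∃ φ : CharacterModule S, IsLeftGenerating φ) :
    ∃ φ : CharacterModule (Matrix ι ι S), IsLeftGenerating φ := by
  obtain ⟨φ, hφ⟩ := h
  let ψ : CharacterModule (Matrix ι ι S) :=
    AddMonoidHom.comp φ (Matrix.traceAddMonoidHom ι S)
  refine ⟨ψ, fun a ha => Matrix.ext fun p q => hφ _ fun r => ?_⟩
  have h : φ (Matrix.single q p r * a).trace = 0 := ha (Matrix.single q p r)
  rwa [Matrix.trace_single_mul] at h

theorem exists_isLeftGenerating_pi {ι : Type*} [Finite ι] {S : ι → Type*} [∀ i, Ring (S i)]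
    (h : ∀ i, ∃ φ : CharacterModule (S i), IsLeftGenerating φ) :
    ∃ φ : CharacterModule (Π i, S i), IsLeftGenerating φ := by
  classical
  cases nonempty_fintype ι
  choose φ hφ using h
  let ψ : CharacterModule (Π i, S i) :=
    ∑ i, AddMonoidHom.comp (φ i) (Pi.evalAddMonoidHom S i)
  have hψ (s : Π i, S i) : ψ s = ∑ i, φ i (s i) := AddMonoidHom.finsetSum_apply _ _ _
  refine ⟨ψ, fun a ha => funext fun i => hφ i _ fun r => ?_⟩
  have h := ha (Pi.single i r)
  rw [hψ, Finset.sum_eq_single i] at h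
  · simpa using h
  · intro j _ hj
    simp [Pi.single_eq_of_ne hj]
  · simp

theorem exists_isLeftGenerating_of_ringEquiv (e : R ≃+* S)
    (h : ∃ φ : CharacterModule S, IsLeftGenerating φ) :
    ∃ φ : CharacterModule R, IsLeftGenerating φ := by
  obtain ⟨φ, hφ⟩ := h
  let ψ : CharacterModule R := AddMonoidHom.comp φ (e : R →+ S)
  refine ⟨ψ, fun a ha => (map_eq_zero_iff e e.injective).1 (hφ _ fun s => ?_)⟩
  have h : φ (e (e.symm s * a)) = 0 := ha (e.symm s)
  rwa [map_mul, e.apply_symm_apply] at h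

theorem exists_isLeftGenerating_of_isSemisimpleRing (S : Type*) [Ring S] [IsSemisimpleRing S] :
    ∃ φ : CharacterModule S, IsLeftGenerating φ := by
  obtain ⟨n, D, k, _, _, -, ⟨e⟩⟩ := IsSemisimpleRing.exists_algEquiv_pi_matrix_divisionRing ℤ S
  exact exists_isLeftGenerating_of_ringEquiv e.toRingEquiv <| exists_isLeftGenerating_pi fun i =>
    exists_isLeftGenerating_matrix _ (exists_isLeftGenerating_of_divisionRing (D i))

/-- A nonzero left ideal in the kernel of a character would contain a simple one, so only the
values of the character on the socle matter. -/
theorem exists_isLeftGenerating_of_socle_embedding [IsArtinianRing R]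
    {j : socle R R →ₗ[R] R ⧸ Ring.jacobson R} (hj : Function.Injective j) :
    ∃ φ : CharacterModule R, IsLeftGenerating φ := by
  obtain ⟨ψ, hψ⟩ := exists_isLeftGenerating_of_isSemisimpleRing (R ⧸ Ring.jacobson R)
  let ψj : CharacterModule (socle R R) := AddMonoidHom.comp ψ (j : socle R R →+ _)
  obtain ⟨φ, hφ⟩ := CharacterModule.dual_surjective_of_injective (R := ℤ)
    ((socle R R).subtype.restrictScalars ℤ) Subtype.val_injective ψj
  have hφj (x : socle R R) : φ x = ψ (j x) := DFunLike.congr_fun hφ x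
  refine ⟨φ, fun a ha => ?_⟩
  by_contra hne
  obtain ⟨N, hN, hNa⟩ := (eq_bot_or_exists_atom_le (Submodule.span R {a})).resolve_left (by simpa)
  have hsoc : N ≤ socle R R := le_sSup (isSimpleModule_iff_isAtom.2 hN)
  have hφN (b : R) (hb : b ∈ N) : φ b = 0 := by
    obtain ⟨s, rfl⟩ := Submodule.mem_span_singleton.1 (hNa hb)
    exact ha s
  obtain ⟨b, hb, hb0⟩ := N.ne_bot_iff.1 hN.1
  have hjb : j ⟨b, hsoc hb⟩ = 0 := hψ _ fun s => by
    obtain ⟨r, rfl⟩ := Ideal.Quotient.mk_surjective s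
    have hr : j (r • ⟨b, hsoc hb⟩) = Ideal.Quotient.mk (Ring.jacobson R) r * j ⟨b, hsoc hb⟩ :=
      map_smul j r _
    rw [← hr, ← hφj]
    exact hφN _ (N.smul_mem r hb)
  exact hb0 (congrArg Subtype.val ((map_eq_zero_iff j hj).1 hjb))

end GeneratingCharacter

section Duality

theorem exists_injective_addChar_ratAddCircle :
    ∃ χ : AddChar (AddCircle (1 : ℚ)) ℂ, Function.Injective χ := by
  let g : AddCircle (1 : ℚ) →+ AddCircle (1 : ℝ) :=
    QuotientAddGroup.map _ _ (Rat.castHom ℝ).toAddMonoidHom (by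
      rintro _ ⟨n, rfl⟩
      exact ⟨n, by simp⟩)
  have hg : Function.Injective g := by
    refine (injective_iff_map_eq_zero g).2 fun x hx => ?_
    obtain ⟨q, rfl⟩ := QuotientAddGroup.mk_surjective x
    obtain ⟨n, hn⟩ := (AddCircle.coe_eq_zero_iff (1 : ℝ)).1 hx
    exact (AddCircle.coe_eq_zero_iff (1 : ℚ)).2 ⟨n, Rat.cast_injective (α := ℝ) (by simpa using hn)⟩
  let χ : AddChar (AddCircle (1 : ℝ)) ℂ :=
    { toFun x := x.toCircle
      map_zero_eq_one' := by simp
      map_add_eq_mul' x y := by simp [AddCircle.toCircle_add] }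
  exact ⟨χ.compAddMonoidHom g,
    (Circle.coe_injective.comp (AddCircle.injective_toCircle one_ne_zero)).comp hg⟩

theorem sum_addChar_comp_eq_ite {A K M : Type*} [AddCommGroup A] [CommRing K] [IsDomain K]
    [AddGroup M] [Fintype M] {χ : AddChar A K} (hχ : Function.Injective χ) (g : M →+ A)
    [Decidable (g = 0)] : ∑ v, χ (g v) = if g = 0 then (Nat.card M : K) else 0 := by
  classical
  have h : χ.compAddMonoidHom g = 0 ↔ g = 0 := by
    simp only [DFunLike.ext_iff, AddChar.compAddMonoidHom_apply, AddChar.zero_apply,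
      AddMonoidHom.zero_apply, hχ.eq_iff' χ.map_zero_eq_one]
  rw [Nat.card_eq_fintype_card, ← if_congr h rfl rfl]
  exact AddChar.sum_eq_ite (χ.compAddMonoidHom g)

theorem card_mul_card_ker_flip {M N : Type*} [AddGroup M] [AddGroup N] [Finite M] [Finite N]
    (p : M →+ N →+ AddCircle (1 : ℚ)) :
    Nat.card M * Nat.card p.flip.ker = Nat.card N * Nat.card p.ker := by
  classical
  cases nonempty_fintype M
  cases nonempty_fintype N
  obtain ⟨χ, hχ⟩ := exists_injective_addChar_ratAddCircle
  have hcomm : ∑ u, ∑ v, χ (p.flip u v) = ∑ v, ∑ u, χ (p v u) := Finset.sum_comm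
  have hcard : (Nat.card p.flip.ker * Nat.card M : ℂ) = Nat.card p.ker * Nat.card N := by
    simpa only [sum_addChar_comp_eq_ite hχ, ← Finset.sum_filter, Finset.sum_const, nsmul_eq_mul,
      ← Fintype.card_subtype, ← Nat.card_eq_fintype_card, ← AddMonoidHom.mem_ker] using hcomm
  rw [mul_comm, mul_comm (Nat.card N)]
  exact_mod_cast hcard

theorem IsLeftGenerating.eq_zero_of_forall_mul_right {R : Type*} [Ring R] [Finite R]
    {φ : CharacterModule R} (hφ : IsLeftGenerating φ) {a : R} (ha : ∀ r, φ (a * r) = 0) :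
    a = 0 := by
  let p : R →+ R →+ AddCircle (1 : ℚ) := AddMonoidHom.mul.compr₂ φ
  have hleft : p.flip.ker = ⊥ :=
    (AddSubgroup.eq_bot_iff_forall _).2 fun b hb => hφ b (DFunLike.congr_fun hb)
  have hright : p.ker = ⊥ := by
    have h := card_mul_card_ker_flip p
    rw [hleft, AddSubgroup.card_bot] at h
    exact AddSubgroup.eq_bot_of_card_eq _ (Nat.eq_of_mul_eq_mul_left Nat.card_pos h).symm
  exact AddSubgroup.mem_bot.1 (hright ▸ (DFunLike.ext _ _ ha : a ∈ p.ker))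

end Duality

section ShortenedCodes

variable {R : Type*} [Ring R] {n : ℕ}

/-- The number of words of `C` with support in `J`, that is, the size of the code obtained by
shortening `C` outside `J`. -/
noncomputable def shortenedCard (C : Set (Fin n → R)) (J : Finset (Fin n)) : ℕ :=
  {u ∈ C | supp u ⊆ J}.ncard

theorem supp_subset_iff {u : Fin n → R} {J : Finset (Fin n)} :
    supp u ⊆ J ↔ ∀ i ∉ J, u i = 0 := by
  simp only [supp, Finset.subset_iff, Finset.mem_filter_univ, not_imp_comm]

/-- The additive group of all vectors with support in `J`. -/
def suppSubgroup (R : Type*) [Ring R] {n : ℕ} (J : Finset (Fin n)) : AddSubgroup (Fin n → R) :=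
  AddSubgroup.pi (J : Set (Fin n))ᶜ fun _ => ⊥

theorem mem_suppSubgroup {u : Fin n → R} {J : Finset (Fin n)} :
    u ∈ suppSubgroup R J ↔ supp u ⊆ J :=
  supp_subset_iff.symm

theorem card_suppSubgroup (R : Type*) [Ring R] {n : ℕ} (J : Finset (Fin n)) :
    Nat.card (suppSubgroup R J) = Nat.card R ^ J.card := by
  classical
  have h : (suppSubgroup R J : Set (Fin n → R)) =
      Set.univ.pi fun i => if i ∈ J then Set.univ else {0} := by
    ext u
    simp [mem_suppSubgroup, supp_subset_iff]
  calc Nat.card (suppSubgroup R J)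
      = ∏ i : Fin n, Nat.card ((if i ∈ J then Set.univ else {0} : Set R)) := by
        rw [← Nat.card_pi, ← Nat.card_congr (Equiv.Set.univPi _), ← h]
        rfl
    _ = ∏ i : Fin n, if i ∈ J then Nat.card R else 1 :=
        Finset.prod_congr rfl fun i _ => by split_ifs <;> simp
    _ = Nat.card R ^ J.card := by simp

theorem forall_mem_suppSubgroup_dotProduct_iff [Finite R] {φ : CharacterModule R}
    (hφ : IsLeftGenerating φ) {v : Fin n → R} {J : Finset (Fin n)} :
    (∀ u ∈ suppSubgroup R J, φ (v ⬝ᵥ u) = 0) ↔ supp v ⊆ Jᶜ := by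
  simp only [mem_suppSubgroup, supp_subset_iff, Finset.mem_compl, not_not]
  constructor
  · intro h i hi
    refine hφ.eq_zero_of_forall_mul_right fun r => ?_
    rw [← dotProduct_single]
    exact h _ fun k hk => Pi.single_eq_of_ne (M := fun _ => R) (by rintro rfl; exact hk hi) r
  · intro hv u hu
    have hvu : v ⬝ᵥ u = 0 := Finset.sum_eq_zero fun i _ => by
      by_cases hi : i ∈ J
      · rw [hv i hi, zero_mul]
      · rw [hu i hi, mul_zero]
    rw [hvu, map_zero]

theorem card_mul_ncard_inter_rightDual [Finite R] {φ : CharacterModule R}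
    (hφ : IsLeftGenerating φ) (D : Submodule R (Fin n → R)) (E : AddSubgroup (Fin n → R)) :
    Nat.card D * {u ∈ (rightDual D : Set (Fin n → R)) | u ∈ E}.ncard =
      Nat.card E * {v ∈ (D : Set (Fin n → R)) | ∀ u ∈ E, φ (v ⬝ᵥ u) = 0}.ncard := by
  let p : D →+ E →+ AddCircle (1 : ℚ) :=
    AddMonoidHom.mk' (fun v => AddMonoidHom.mk' (fun u => φ (v.1 ⬝ᵥ u.1)) fun u u' => by
      simp [dotProduct_add]) fun v v' => by ext u; simp [add_dotProduct]
  have hdual : {u ∈ (rightDual D : Set (Fin n → R)) | u ∈ E} =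
      Subtype.val '' (p.flip.ker : Set E) := by
    ext u
    constructor
    · rintro ⟨hu, huE⟩
      refine ⟨⟨u, huE⟩, DFunLike.ext _ _ fun v => ?_, rfl⟩
      exact (congrArg φ (hu v.1 v.2)).trans (map_zero φ)
    · rintro ⟨⟨u, huE⟩, hu, rfl⟩
      refine ⟨fun v hv => hφ _ fun r => ?_, huE⟩
      rw [← smul_eq_mul, ← smul_dotProduct]
      exact DFunLike.congr_fun hu ⟨r • v, D.smul_mem r hv⟩
  have hcode : {v ∈ (D : Set (Fin n → R)) | ∀ u ∈ E, φ (v ⬝ᵥ u) = 0} =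
      Subtype.val '' (p.ker : Set D) := by
    ext v
    constructor
    · rintro ⟨hv, hvE⟩
      exact ⟨⟨v, hv⟩, DFunLike.ext _ _ fun u => hvE u.1 u.2, rfl⟩
    · rintro ⟨v, hv, rfl⟩
      exact ⟨v.2, fun u hu => DFunLike.congr_fun hv ⟨u, hu⟩⟩
  rw [hdual, hcode, Set.ncard_image_of_injective _ Subtype.val_injective,
    Set.ncard_image_of_injective _ Subtype.val_injective]
  exact card_mul_card_ker_flip p

theorem card_mul_shortenedCard_rightDual [Finite R] {φ : CharacterModule R}
    (hφ : IsLeftGenerating φ) (D : Submodule R (Fin n → R)) (J : Finset (Fin n)) :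
    Nat.card D * shortenedCard (rightDual D : Set (Fin n → R)) J =
      Nat.card R ^ J.card * shortenedCard (D : Set (Fin n → R)) Jᶜ := by
  have h := card_mul_ncard_inter_rightDual hφ D (suppSubgroup R J)
  simp only [forall_mem_suppSubgroup_dotProduct_iff hφ] at h
  rw [card_suppSubgroup] at h
  simp only [mem_suppSubgroup] at h
  exact h

theorem sum_tupleCount [Finite R] (m : ℕ) (C : Set (Fin n → R)) (J : Finset (Fin n)) :
    ∑ T ∈ J.powerset, tupleCount m C T = shortenedCard C J ^ m := by
  classical
  cases nonempty_fintype C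
  let support (u : Fin m → C) : Finset (Fin n) := Finset.univ.biUnion fun i => supp (u i).1
  let e : {u : Fin m → C // support u ⊆ J} ≃ (Fin m → {u ∈ C | supp u ⊆ J}) :=
    { toFun u i := ⟨u.1 i, (u.1 i).2, Finset.biUnion_subset.1 u.2 i (Finset.mem_univ i)⟩
      invFun u := ⟨fun i => ⟨u i, (u i).2.1⟩, Finset.biUnion_subset.2 fun i _ => (u i).2.2⟩ }
  have hfiber : ∑ T ∈ J.powerset, tupleCount m C T = Nat.card {u // support u ⊆ J} := by
    simp only [tupleCount, Nat.card_eq_fintype_card, Fintype.card_subtype]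
    rw [Finset.card_eq_sum_card_fiberwise (f := support) (t := J.powerset) (by simp [Set.MapsTo])]
    refine Finset.sum_congr rfl fun T hT => ?_
    rw [Finset.filter_filter]
    congr! 2 with u
    exact ⟨fun h => ⟨h.trans_subset (Finset.mem_powerset.1 hT), h⟩, And.right⟩
  rw [hfiber, Nat.card_congr e, Nat.card_fun, Nat.card_fin, Nat.card_coe_set_eq, shortenedCard]

end ShortenedCodes

section Harmonic

variable {n d : ℕ} {f : Layer n d →₀ ℝ} {A : Type*} [CommRing A]

theorem gamma_apply (f : Layer n d →₀ ℝ) (Y : LowerLayer n d) :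
    gamma n d f Y = ∑ Z : Layer n d with Y.1 ⊆ Z.1, f Z := by
  classical
  rw [gamma, Finsupp.linearCombination_apply, Finsupp.sum_fintype _ _ (by simp),
    Finsupp.finsetSum_apply, Finset.sum_filter]
  refine Finset.sum_congr rfl fun Z _ => ?_
  simp [Finsupp.single_apply, Finset.sum_ite_eq']

theorem sum_compl_sum_insert_subset (f : Layer n d →₀ ℝ) (Y : Finset (Fin n)) :
    ∑ e ∈ Yᶜ, ∑ Z : Layer n d with insert e Y ⊆ Z.1, f Z =
      (d - Y.card : ℝ) * ∑ Z : Layer n d with Y ⊆ Z.1, f Z := by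
  rw [Finset.sum_comm' (t' := {Z : Layer n d | Y ⊆ Z.1}) (s' := fun Z => Z.1 \ Y), Finset.mul_sum]
  · refine Finset.sum_congr rfl fun Z hZ => ?_
    rw [Finset.sum_const, nsmul_eq_mul,
      Finset.cast_card_sdiff (Finset.mem_filter.1 hZ).2, Z.2]
  · intro e Z
    simp only [Finset.mem_compl, Finset.mem_filter_univ, Finset.insert_subset_iff,
      Finset.mem_sdiff]
    tauto

theorem sum_superset_eq_zero (hf : f ∈ Harm n d) {Y : Finset (Fin n)} (hY : Y.card < d) :
    ∑ Z : Layer n d with Y ⊆ Z.1, f Z = 0 := by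
  obtain ⟨k, hk⟩ := Nat.exists_eq_add_of_lt hY
  induction k generalizing Y with
  | zero =>
    rw [← gamma_apply f ⟨Y, hk.symm⟩, LinearMap.mem_ker.1 hf, Finsupp.coe_zero, Pi.zero_apply]
  | succ k ih =>
    have hinsert : ∑ e ∈ Yᶜ, ∑ Z : Layer n d with insert e Y ⊆ Z.1, f Z = 0 :=
      Finset.sum_eq_zero fun e he => by
        have := Finset.card_insert_of_notMem (Finset.mem_compl.1 he)
        exact ih (by omega) (by omega)
    rw [sum_compl_sum_insert_subset] at hinsert
    exact (mul_eq_zero.1 hinsert).resolve_left (sub_ne_zero.2 (by exact_mod_cast hY.ne'))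

theorem sum_superset_eq_sum_eq (hf : f ∈ Harm n d) (Y : Finset (Fin n)) :
    ∑ Z : Layer n d with Y ⊆ Z.1, f Z = ∑ Z : Layer n d with Y = Z.1, f Z := by
  rcases lt_or_ge Y.card d with hY | hY
  · rw [sum_superset_eq_zero hf hY, Finset.sum_filter]
    exact (Finset.sum_eq_zero fun Z _ => if_neg fun h => hY.ne (by rw [h, Z.2])).symm
  · refine Finset.sum_congr (Finset.filter_congr fun Z _ => ?_) fun _ _ => rfl
    exact ⟨fun h => Finset.eq_of_subset_of_card_le h (Z.2.trans_le hY), fun h => h.subset⟩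

theorem pow_card_inter_mul_pow_card_sdiff {α : Type*} [DecidableEq α] (a b : A)
    (Z J : Finset α) :
    a ^ (Z ∩ J).card * b ^ (Z \ J).card =
      ∑ Y ∈ J.powerset with Y ⊆ Z, (a - b) ^ Y.card * b ^ (Z.card - Y.card) := by
  have hpowerset : (Z ∩ J).powerset = {Y ∈ J.powerset | Y ⊆ Z} := by
    ext Y
    rw [Finset.mem_powerset, Finset.subset_inter_iff, Finset.mem_filter, Finset.mem_powerset,
      and_comm]
  rw [← hpowerset, ← sub_add_cancel a b, ← Finset.sum_pow_mul_eq_add_pow, sub_add_cancel,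
    Finset.sum_mul]
  refine Finset.sum_congr rfl fun Y hY => ?_
  have hle := Finset.card_le_card (Finset.mem_powerset.1 hY)
  have hcard := Finset.card_inter_add_card_sdiff Z J
  rw [mul_assoc, ← pow_add]
  congr 2
  omega

variable [Algebra ℝ A]

/-- Writing `a = (a - b) + b`, the left side becomes a combination of the sums of `f` over the
supersets of `Y`, and only those with `Y.card = d` survive. -/
theorem sum_smul_pow_mul_pow (hf : f ∈ Harm n d) (J : Finset (Fin n)) (a b : A) :
    ∑ Z, f Z • (a ^ (Z.1 ∩ J).card * b ^ (Z.1 \ J).card) = tilde f J • (a - b) ^ d := by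
  have hcard (Z : Layer n d) : Z.1.card = d := Z.2
  calc ∑ Z, f Z • (a ^ (Z.1 ∩ J).card * b ^ (Z.1 \ J).card)
      = ∑ Z, ∑ Y ∈ J.powerset with Y ⊆ Z.1,
          f Z • ((a - b) ^ Y.card * b ^ (d - Y.card)) := by
        simp only [pow_card_inter_mul_pow_card_sdiff, Finset.smul_sum, hcard]
    _ = ∑ Y ∈ J.powerset, (∑ Z : Layer n d with Y ⊆ Z.1, f Z) •
          ((a - b) ^ Y.card * b ^ (d - Y.card)) := by
        simp only [Finset.sum_smul]
        exact Finset.sum_comm' fun Z Y => by simp [and_comm]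
    _ = ∑ Y ∈ J.powerset, ∑ Z : Layer n d with Y = Z.1,
          f Z • ((a - b) ^ Y.card * b ^ (d - Y.card)) := by
        simp only [sum_superset_eq_sum_eq hf, Finset.sum_smul]
    _ = ∑ Z : Layer n d with Z.1 ⊆ J, ∑ Y ∈ {Z.1},
          f Z • ((a - b) ^ Y.card * b ^ (d - Y.card)) :=
        Finset.sum_comm' fun Y Z => by
          simp only [Finset.mem_powerset, Finset.mem_filter_univ, Finset.mem_singleton]
          exact ⟨fun ⟨h, e⟩ => ⟨e, e ▸ h⟩, fun ⟨e, h⟩ => ⟨e ▸ h, e⟩⟩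
    _ = tilde f J • (a - b) ^ d := by
        simp [tilde, Finset.sum_smul, hcard]

theorem tilde_compl (hf : f ∈ Harm n d) (J : Finset (Fin n)) :
    tilde f Jᶜ = (-1) ^ d * tilde f J := by
  have h := sum_smul_pow_mul_pow hf J (0 : ℝ) 1
  rw [zero_sub, smul_eq_mul, mul_comm] at h
  rw [← h, tilde, Finset.sum_filter]
  refine Finset.sum_congr rfl fun Z _ => ?_
  simp [zero_pow_eq, Finset.subset_compl_iff_disjoint_right, Finset.disjoint_iff_inter_eq_empty]

theorem le_card_of_tilde_ne_zero {J : Finset (Fin n)} (h : tilde f J ≠ 0) : d ≤ J.card := by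
  obtain ⟨Z, hZ, -⟩ := Finset.exists_ne_zero_of_sum_ne_zero h
  exact Z.2.symm.trans_le (Finset.card_le_card (Finset.mem_filter.1 hZ).2)

theorem le_card_compl_of_tilde_ne_zero (hf : f ∈ Harm n d) {J : Finset (Fin n)}
    (h : tilde f J ≠ 0) : d ≤ Jᶜ.card :=
  le_card_of_tilde_ne_zero (f := f) (tilde_compl hf J ▸ mul_ne_zero (by simp) h)

theorem sum_superset_pow_card_mul_pow_card_compl {α K : Type*} [Fintype α] [DecidableEq α]
    [CommSemiring K] (a b : K) (S : Finset α) :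
    ∑ J with S ⊆ J, a ^ J.card * b ^ Jᶜ.card = a ^ S.card * (a + b) ^ Sᶜ.card := by
  rw [← Finset.sum_pow_mul_eq_add_pow, Finset.mul_sum]
  refine Finset.sum_nbij' (· \ S) (S ∪ ·) ?_ ?_ ?_ ?_ ?_
  · intro J _
    simp [Finset.subset_compl_iff_disjoint_right, Finset.sdiff_disjoint]
  · simp
  · intro J hJ
    exact Finset.union_sdiff_of_subset (Finset.mem_filter.1 hJ).2
  · intro Y hY
    rw [Finset.union_sdiff_cancel_left]
    simpa [Finset.subset_compl_iff_disjoint_left] using hY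
  · intro J hJ
    have hSJ := (Finset.mem_filter.1 hJ).2
    have hsdiff := Finset.card_sdiff_add_card_eq_card hSJ
    rw [← mul_assoc, ← pow_add, Finset.card_compl, Finset.card_compl]
    congr 2 <;> omega

theorem sum_superset_tilde_smul (f : Layer n d →₀ ℝ) (T : Finset (Fin n)) (x y : A) :
    ∑ J with T ⊆ J, tilde f J • (y ^ J.card * (x - y) ^ Jᶜ.card) =
      ∑ Z, f Z • (y ^ (T ∪ Z.1).card * x ^ (T ∪ Z.1)ᶜ.card) := by
  simp only [tilde, Finset.sum_smul]
  rw [Finset.sum_comm' (t' := Finset.univ) (s' := fun Z => {J | T ∪ Z.1 ⊆ J})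
    (by simp [Finset.union_subset_iff])]
  refine Finset.sum_congr rfl fun Z _ => ?_
  rw [← Finset.smul_sum, sum_superset_pow_card_mul_pow_card_compl, add_sub_cancel]

theorem pow_mul_sum_superset_tilde_smul (hf : f ∈ Harm n d) (T : Finset (Fin n)) (x y : A) :
    x ^ d * ∑ J with T ⊆ J, tilde f J • (y ^ J.card * (x - y) ^ Jᶜ.card) =
      (x - y) ^ d * (tilde f T • (x ^ Tᶜ.card * y ^ T.card)) := by
  have hmonomial (Z : Layer n d) : x ^ d * (y ^ (T ∪ Z.1).card * x ^ (T ∪ Z.1)ᶜ.card) =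
      (x ^ Tᶜ.card * y ^ T.card) * (x ^ (Z.1 ∩ T).card * y ^ (Z.1 \ T).card) := by
    have hinter := Finset.card_inter_add_card_sdiff Z.1 T
    have hunion := Finset.card_union_add_card_inter T Z.1
    have hT := Finset.card_add_card_compl T
    have hTZ := Finset.card_add_card_compl (T ∪ Z.1)
    have hZ := Z.2
    rw [Finset.inter_comm] at hunion
    rw [mul_left_comm, ← pow_add, mul_mul_mul_comm, ← pow_add, ← pow_add, mul_comm]
    congr 2 <;> omega
  calc x ^ d * ∑ J with T ⊆ J, tilde f J • (y ^ J.card * (x - y) ^ Jᶜ.card)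
      = (x ^ Tᶜ.card * y ^ T.card) *
          ∑ Z, f Z • (x ^ (Z.1 ∩ T).card * y ^ (Z.1 \ T).card) := by
        simp only [sum_superset_tilde_smul, Finset.mul_sum, mul_smul_comm, hmonomial]
    _ = (x - y) ^ d * (tilde f T • (x ^ Tᶜ.card * y ^ T.card)) := by
        rw [sum_smul_pow_mul_pow hf, mul_smul_comm, mul_smul_comm, mul_comm]

end Harmonic

section Enumerator

open MvPolynomial

variable {n d : ℕ} {f : Layer n d →₀ ℝ}

/-- The quotient by `(xy)^d` of the harmonic weight enumerator, in terms of the numbers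
`B J = |C(J)| ^ m`, where `C(J)` consists of the words of `C` with support in `J`. For harmonic
`f` the terms whose truncated exponents are not the true differences vanish with `tilde f J`. -/
noncomputable def harmonicQuotient (f : Layer n d →₀ ℝ) (B : Finset (Fin n) → ℝ) :
    MvPolynomial (Fin 2) ℝ :=
  ∑ J, (tilde f J * B J) • (X 1 ^ (J.card - d) * (X 0 - X 1) ^ (Jᶜ.card - d))

theorem pow_mul_harmonicQuotient (hf : f ∈ Harm n d) (B : Finset (Fin n) → ℝ) :
    (X 1 * (X 0 - X 1)) ^ d * harmonicQuotient f B =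
      ∑ J, (tilde f J * B J) • (X 1 ^ J.card * (X 0 - X 1) ^ Jᶜ.card) := by
  rw [harmonicQuotient, Finset.mul_sum]
  refine Finset.sum_congr rfl fun J _ => ?_
  by_cases h : tilde f J = 0
  · simp [h]
  · rw [mul_smul_comm, mul_pow, mul_mul_mul_comm, pow_mul_pow_sub _ (le_card_of_tilde_ne_zero h),
      pow_mul_pow_sub _ (le_card_compl_of_tilde_ne_zero hf h)]

theorem sum_tilde_mul_eq_pow_mul_harmonicQuotient (hf : f ∈ Harm n d) (a : Finset (Fin n) → ℝ) :
    ∑ T, C (tilde f T * a T) * X 0 ^ Tᶜ.card * X 1 ^ T.card =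
      (X 0 * X 1) ^ d * harmonicQuotient f fun J => ∑ T ∈ J.powerset, a T := by
  have hne : (X 0 - X 1 : MvPolynomial (Fin 2) ℝ) ^ d ≠ 0 :=
    pow_ne_zero _ (sub_ne_zero.2 fun h => zero_ne_one (X_injective h))
  refine mul_left_cancel₀ hne ?_
  calc (X 0 - X 1 : MvPolynomial (Fin 2) ℝ) ^ d *
        ∑ T, C (tilde f T * a T) * X 0 ^ Tᶜ.card * X 1 ^ T.card
      = ∑ T, a T • ((X 0 - X 1) ^ d * (tilde f T • (X 0 ^ Tᶜ.card * X 1 ^ T.card))) := by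
        rw [Finset.mul_sum]
        refine Finset.sum_congr rfl fun T _ => ?_
        rw [mul_smul_comm, smul_smul, mul_comm (a T), mul_assoc (C _), ← smul_eq_C_mul,
          mul_smul_comm]
    _ = X 0 ^ d * ∑ T, ∑ J with T ⊆ J,
          (tilde f J * a T) • (X 1 ^ J.card * (X 0 - X 1) ^ Jᶜ.card) := by
        rw [Finset.mul_sum]
        refine Finset.sum_congr rfl fun T _ => ?_
        rw [← pow_mul_sum_superset_tilde_smul hf, ← mul_smul_comm, Finset.smul_sum]
        simp only [smul_smul, mul_comm (a T)]
    _ = X 0 ^ d * ∑ J, (tilde f J * ∑ T ∈ J.powerset, a T) •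
          (X 1 ^ J.card * (X 0 - X 1) ^ Jᶜ.card) := by
        simp only [Finset.mul_sum (Finset.powerset _), Finset.sum_smul]
        rw [Finset.sum_comm' (t' := Finset.univ) (s' := Finset.powerset) (by simp)]
    _ = (X 0 - X 1) ^ d *
          ((X 0 * X 1) ^ d * harmonicQuotient f fun J => ∑ T ∈ J.powerset, a T) := by
        rw [← pow_mul_harmonicQuotient hf, mul_pow, mul_pow]
        ring

theorem harmonicQuotient_isHomogeneous (hf : f ∈ Harm n d) (B : Finset (Fin n) → ℝ) :
    (harmonicQuotient f B).IsHomogeneous (n - 2 * d) := by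
  refine IsHomogeneous.sum _ _ _ fun J _ => ?_
  by_cases h : tilde f J = 0
  · simp [h, isHomogeneous_zero]
  have hJ := le_card_of_tilde_ne_zero h
  have hJc := le_card_compl_of_tilde_ne_zero hf h
  have hn : J.card + Jᶜ.card = n := by simp
  have hdeg : n - 2 * d = 1 * (J.card - d) + 1 * (Jᶜ.card - d) := by omega
  rw [smul_eq_C_mul, hdeg]
  exact (((isHomogeneous_X ℝ 1).pow _).mul
    (((isHomogeneous_X ℝ 0).sub (isHomogeneous_X ℝ 1)).pow _)).C_mul _

theorem harmonicQuotient_eq_zero (hf : f ∈ Harm n d) (B : Finset (Fin n) → ℝ)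
    (hn : n < 2 * d) : harmonicQuotient f B = 0 := by
  refine Finset.sum_eq_zero fun J _ => ?_
  have hJ : tilde f J = 0 := by
    by_contra h
    have hJ := le_card_of_tilde_ne_zero h
    have hJc := le_card_compl_of_tilde_ne_zero hf h
    have hcard : J.card + Jᶜ.card = n := by simp
    omega
  rw [hJ, zero_mul, zero_smul]

theorem harmonicQuotient_eq_aeval (hf : f ∈ Harm n d) {B B' : Finset (Fin n) → ℝ} {q c : ℝ}
    (hB : ∀ J, B' Jᶜ = q ^ Jᶜ.card / c * B J) :
    harmonicQuotient f B' = C ((-1) ^ d * (q ^ d / c)) *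
      aeval ![X 0 + C (q - 1) * X 1, X 0 - X 1] (harmonicQuotient f B) := by
  have hsub : (X 0 + C (q - 1) * X 1 - (X 0 - X 1) : MvPolynomial (Fin 2) ℝ) = C q * X 1 := by
    rw [C_sub, C_1]
    ring
  rw [← smul_eq_C_mul]
  simp only [harmonicQuotient, map_sum, map_smul, map_mul, map_pow, map_sub (aeval _), aeval_X,
    Matrix.cons_val_zero, Matrix.cons_val_one, hsub]
  rw [Finset.smul_sum, ← Equiv.sum_comp compl_involutive.toPerm]
  refine Finset.sum_congr rfl fun J _ => ?_
  rw [Function.Involutive.coe_toPerm, compl_compl, tilde_compl hf, hB]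
  by_cases h : tilde f J = 0
  · simp [h]
  obtain ⟨k, hk⟩ := Nat.exists_eq_add_of_le (le_card_compl_of_tilde_ne_zero hf h)
  rw [hk, Nat.add_sub_cancel_left, mul_pow (C q), ← C_pow, ← smul_eq_C_mul, mul_smul_comm,
    smul_smul, smul_smul, mul_comm (X 1 ^ k)]
  congr 1
  ring

variable {R : Type*} [Ring R] [Finite R]

theorem harmonicWeightEnumerator_eq (hf : f ∈ Harm n d) (m : ℕ) (C : Set (Fin n → R)) :
    harmonicWeightEnumerator m C f =
      (X 0 * X 1) ^ d * harmonicQuotient f fun J => (shortenedCard C J : ℝ) ^ m := by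
  rw [harmonicWeightEnumerator, sum_tilde_mul_eq_pow_mul_harmonicQuotient hf]
  simp only [← Nat.cast_sum, sum_tupleCount, Nat.cast_pow]

theorem shortenedCard_rightDual_compl_pow {φ : CharacterModule R} (hφ : IsLeftGenerating φ)
    (m : ℕ) (D : Submodule R (Fin n → R)) (J : Finset (Fin n)) :
    (shortenedCard (rightDual D : Set (Fin n → R)) Jᶜ : ℝ) ^ m =
      ((Nat.card R : ℝ) ^ m) ^ Jᶜ.card / (Nat.card D : ℝ) ^ m *
        (shortenedCard (D : Set (Fin n → R)) J : ℝ) ^ m := by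
  have hD : (Nat.card D : ℝ) ≠ 0 := by exact_mod_cast Nat.card_pos.ne'
  have h := card_mul_shortenedCard_rightDual hφ D Jᶜ
  rw [compl_compl] at h
  rw [pow_right_comm, ← div_pow, ← mul_pow, div_mul_eq_mul_div]
  refine congrArg (· ^ m) (eq_div_of_mul_eq hD ?_)
  rw [mul_comm]
  exact_mod_cast h

end Enumerator

end HarmonicCodes

open HarmonicCodes MvPolynomial in
theorem theorem3p2_general {R : Type*} [Ring R] [Finite R] {φ : CharacterModule R}
    (hφ : IsLeftGenerating φ) (m n d : ℕ) (D : Submodule R (Fin n → R)) (f : Layer n d →₀ ℝ)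
    (hf : f ∈ Harm n d) :
    ∃ Z Z' : MvPolynomial (Fin 2) ℝ,
      harmonicWeightEnumerator m (D : Set (Fin n → R)) f = (X 0 * X 1) ^ d * Z ∧
      harmonicWeightEnumerator m (rightDual D : Set (Fin n → R)) f = (X 0 * X 1) ^ d * Z' ∧
      Z.IsHomogeneous (n - 2 * d) ∧
      Z'.IsHomogeneous (n - 2 * d) ∧
      (n < 2 * d → Z = 0 ∧ Z' = 0) ∧
      Z' = C ((-1 : ℝ) ^ d * (((Nat.card R : ℝ) ^ m) ^ d / (Nat.card D : ℝ) ^ m)) *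
        aeval ![X 0 + C ((Nat.card R : ℝ) ^ m - 1) * X 1, X 0 - X 1] Z :=
  ⟨_, _, harmonicWeightEnumerator_eq hf m _, harmonicWeightEnumerator_eq hf m _,
    harmonicQuotient_isHomogeneous hf _, harmonicQuotient_isHomogeneous hf _,
    fun hn => ⟨harmonicQuotient_eq_zero hf _ hn, harmonicQuotient_eq_zero hf _ hn⟩,
    harmonicQuotient_eq_aeval hf (shortenedCard_rightDual_compl_pow hφ m D)⟩

open HarmonicCodes MvPolynomial in
/-- The quotients `Z` and `Z'` (for `C` and for its dual) are determined by the first two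
equations, as the polynomial ring is a domain. In the degree `n - 2d` the subtraction is
truncated; for `n < 2d` the claim is that the quotients vanish. -/
theorem theorem3p2 {R : Type*} [Ring R] [Finite R] (hR : IsFrobeniusRing R) (m n d : ℕ)
    (D : Submodule R (Fin n → R)) (f : Layer n d →₀ ℝ) (hf : f ∈ Harm n d) :
    ∃ Z Z' : MvPolynomial (Fin 2) ℝ,
      harmonicWeightEnumerator m (D : Set (Fin n → R)) f = (X 0 * X 1) ^ d * Z ∧
      harmonicWeightEnumerator m (rightDual D : Set (Fin n → R)) f = (X 0 * X 1) ^ d * Z' ∧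
      Z.IsHomogeneous (n - 2 * d) ∧
      Z'.IsHomogeneous (n - 2 * d) ∧
      (n < 2 * d → Z = 0 ∧ Z' = 0) ∧
      Z' = C ((-1 : ℝ) ^ d * (((Nat.card R : ℝ) ^ m) ^ d / (Nat.card D : ℝ) ^ m)) *
        aeval ![X 0 + C ((Nat.card R : ℝ) ^ m - 1) * X 1, X 0 - X 1] Z := by
  obtain ⟨φ, hφ⟩ := exists_isLeftGenerating_of_socle_embedding
    (j := hR.left.some.symm.toLinearMap) hR.left.some.symm.injective
  exact theorem3p2_general hφ m n d D f hf
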